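/- Let $N,a$ be integers with $1\le a\le N$. For $\boldsymbol s=(s_1,\dots,s_u)\in\mathbb N^u$ put $$t^\star_{N,a}(\boldsymbol s)=\sum_{k_1\ge\cdots\ge k_u\ge 0}\frac{1}{(Nk_1+a)^{s_1}\cdots(Nk_u+a)^{s_u}},\qquad t^\star_{N,a}(\emptyset)=1,$$ and for $\boldsymbol s=(s_1,\dots,s_u)\in(\mathbb Z\setminus\{0\})^u$ put $$\widetilde t_{N,a}(\boldsymbol s)=\sum_{k_1>\cdots>k_u\ge 0}\frac{\operatorname{sign}(s_1)^{k_1}\cdots\operatorname{sign}(s_u)^{k_u}}{(Nk_1+a)^{|s_1|}\cdots(Nk_u+a)^{|s_u|}}\cdot\frac{\left(\frac{2a}{N}\right)_{k_u}}{k_u!},$$ where $(x)_k=x(x+1)\cdots(x+k-1)$, $(x)_0=1$, and all series are understood as limits, as $n\to\infty$, of the sums restricted to $k_1\le n$. For a real $r$ put $$\widetilde t^{\,r}_{N,a}(s_1,\dots,s_u)=\sum_{\circ="+"\text{ or }","}r^{\#\text{pluses}}\,\widetilde t_{N,a}(s_1\circ s_2\circ\cdots\circ s_u),$$ the sum being over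 all $2^{u-1}$ choices, where merging two entries is defined by $s+l=|s|+|l|$ if $sl>0$ and $s+l=-(|s|+|l|)$ if $sl<0$. A bar over an entry means a minus sign, $\overline{s}=-s$; $\{s\}^m$ denotes $s$ repeated $m$ times (empty if $m=0$); $B$ is the Beta function. Let $d,b_0,b_1,\dots,b_d\in\mathbb N_0$ and let $c_1,\dots,c_d\in\mathbb N$ with $c_1,\dots,c_d\ge 3$; if $d=0$ and $b_0=0$, assume moreover that $a<N$. Then all the series involved converge, and $$t^\star_{N,a}(\{2\}^{b_0},c_1,\{2\}^{b_1},\dots,c_d,\{2\}^{b_d})=\frac{2^{c_1+\cdots+c_d+1-2d}\,N}{B\left(\frac aN,\frac aN\right)}\;\widetilde t^{\,1/2}_{N,a}(\boldsymbol s),$$ where $$\boldsymbol s=\left(\overline{2b_0+2},\{1\}^{c_1-3},2b_1+3,\{1\}^{c_2-3},\dots,2b_{d-1}+3,\{1\}^{c_d-3},2b_d+2\right)\quad\text{if } d\ge 1,$$ and $\boldsymbol s=(\overline{2b_0+1})$ if $d=0$. -/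

import Mathlib

open Filter Topology

/-- Truncated multiple `t`-star value of level `N`: the nested sum over
`n ≥ k₁ ≥ k₂ ≥ ⋯ ≥ k_u ≥ 0` of `1 / ((N k₁ + a)^{s₁} ⋯ (N k_u + a)^{s_u})`. -/
noncomputable def tStarFin (N a : ℕ) : List ℕ → ℕ → ℝ
  | [], _ => 1
  | s :: t, n => ∑ k ∈ Finset.range (n + 1), 1 / ((N : ℝ) * k + a) ^ s * tStarFin N a t k

/-- The multiple `t`-star value of level `N`, as the limit of its truncations. -/
noncomputable def tStar (N a : ℕ) (s : List ℕ) : ℝ :=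
  limUnder atTop (tStarFin N a s)

/-- The factor `sign(s)^k / (N k + a)^{|s|}`. -/
noncomputable def tTerm (N a : ℕ) (s : ℤ) (k : ℕ) : ℝ :=
  (s.sign : ℝ) ^ k / ((N : ℝ) * k + a) ^ s.natAbs

/-- Truncation of the alternating multiple `t`-value of level `N` containing factorial and
Pochhammer symbols: the nested sum over `n > k₁ > k₂ > ⋯ > k_u ≥ 0` of
`∏ᵢ sign(sᵢ)^{kᵢ} / (N kᵢ + a)^{|sᵢ|}` times `(2a/N)_{k_u} / k_u!`. -/
noncomputable def tTildeFin (N a : ℕ) : List ℤ → ℕ → ℝ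
  | [], _ => 1
  | [s], n => ∑ k ∈ Finset.range n,
      tTerm N a s k * ((ascPochhammer ℝ k).eval (2 * (a : ℝ) / N) / (k.factorial : ℝ))
  | s :: s' :: t, n => ∑ k ∈ Finset.range n, tTerm N a s k * tTildeFin N a (s' :: t) k

/-- The alternating multiple `t`-value of level `N` containing factorial and Pochhammer symbols,
as the limit of its truncations. -/
noncomputable def tTilde (N a : ℕ) (s : List ℤ) : ℝ :=
  limUnder atTop (tTildeFin N a s)

/-- Merging of two signed indices: absolute values add and signs multiply. -/
def mergeIndex (s l : ℤ) : ℤ :=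
  if 0 < s * l then |s| + |l| else -(|s| + |l|)

/-- All ways of filling the gaps of the index `(s, t₁, t₂, …)` with a comma or a plus (the
latter merging the neighbouring entries): the list of pairs (number of pluses, resulting index). -/
def contractionsFrom (s : ℤ) : List ℤ → List (ℕ × List ℤ)
  | [] => [(0, [s])]
  | l :: t =>
      (contractionsFrom l t).map (fun p => (p.1, s :: p.2)) ++
        (contractionsFrom (mergeIndex s l) t).map (fun p => (p.1 + 1, p.2))

/-- All ways of filling the gaps of an index with a comma or a plus. -/
def contractions : List ℤ → List (ℕ × List ℤ)
  | [] => [(0, [])]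
  | s :: t => contractionsFrom s t

/-- The interpolated value `∑ r^{#pluses} t̃_{N,a}(s₁ ∘ s₂ ∘ ⋯ ∘ s_u)`, the sum being over
all choices of `∘` among comma and plus. -/
noncomputable def tTildeInterp (N a : ℕ) (r : ℝ) (s : List ℤ) : ℝ :=
  ((contractions s).map fun p => r ^ p.1 * tTilde N a p.2).sum

/-- The index `({2}^{b₀}, c₁, {2}^{b₁}, …, c_d, {2}^{b_d})`; here `c i` is `c_{i+1}`. -/
def blocksOfTwos (d : ℕ) (b : Fin (d + 1) → ℕ) (c : Fin d → ℕ) : List ℕ :=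
  List.replicate (b 0) 2 ++
    (List.ofFn fun i : Fin d => c i :: List.replicate (b i.succ) 2).flatten

/-- The signed index
`(-(2b₀+2), {1}^{c₁-3}, 2b₁+3, {1}^{c₂-3}, …, 2b_{d-1}+3, {1}^{c_d-3}, 2b_d+2)` for `d ≥ 1`,
and `(-(2b₀+1))` for `d = 0`. A negative entry is one that carries a bar. -/
def halfIndex : (d : ℕ) → (Fin (d + 1) → ℕ) → (Fin d → ℕ) → List ℤ
  | 0, b, _ => [-(2 * (b 0 : ℤ) + 1)]
  | d + 1, b, c =>
      [-(2 * (b 0 : ℤ) + 2)] ++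
        (List.ofFn fun i : Fin d =>
          List.replicate (c i.castSucc - 3) (1 : ℤ) ++ [2 * (b i.castSucc.succ : ℤ) + 3]).flatten ++
        List.replicate (c (Fin.last d) - 3) (1 : ℤ) ++ [2 * (b (Fin.last (d + 1)) : ℤ) + 2]

/-!
Put `x = a / N`. The identity is the limit `n → ∞` of an exact identity between finite sums. Let
`K(n, k) = (x)_{n+1}² / ((n-k)! (2x)_{n+k+1})` for `k ≤ n` (`kernel`), let
`Φ f (n) = ∑_{k ≤ n} (-1)^k K(n, k) f(k)` (`kernelSum`), and let `U h (k) = h(k)/2 + ∑_{j<k} h(j)`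
(`halfSum`). Two first-order recurrences of `K`, in `n` and in `k`, give by telescoping

* `∑_{m ≤ n} Φ f (m) / (m+x)² = Φ (f / (k+x)²) (n)` (`sum_kernelSum_div_sq`),
* `Φ f (n) / (n+x) = 2 Φ (U (f / (k+x))) (n)` (`kernelSum_eq_mul_kernelSum_halfSum`),
* `1 = 2 Φ ((2x)_k / (k! (k+x))) (n)` (`kernelSum_weight`).

The third formula represents the truncated star value of the empty index as a transform. By the
first, prepending an entry `2` to a star index raises the leading exponent of the transformed
sequence by two; by the second, prepending `c ≥ 3` raises the leading exponent by one, then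
inserts `c - 3` entries `1` and a new leading exponent `2`, with a factor `2^{c-2}`. Building up
the star index from the right therefore produces exactly the index on the other side
(`tStarFin_blocksOfTwos`). The operators `U` count equality of neighbouring summation variables
with weight `1/2`, which is what interpolation at `r = 1/2` does (`sum_contractionsFrom`).

As `n → ∞`, `K(n, k)` tends to `Γ(2x) / Γ(x)² = 1 / B(x, x)` for each `k`. Since `K(n, k)` is
nonnegative and decreasing in `k`, summation by parts shows that weighting a merely convergent
series by it is harmless (`tendsto_sum_kernel_mul`). The series of the right-hand side converge
absolutely when `d ≥ 1`, by a crude growth bound on the inner sums (`interpSum_le`), and by the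
alternating series test when `d = 0`; convergence of the star value comes out of the finite
identity.
-/

noncomputable section

/-! ### The kernel -/

/-- The summation kernel `(x)_{n+1}² / ((n-k)! (2x)_{n+k+1})`, extended by `0` to `k > n`. -/
def kernel (x : ℝ) (n k : ℕ) : ℝ :=
  if k ≤ n then ((ascPochhammer ℝ (n + 1)).eval x) ^ 2 /
    ((n - k).factorial * (ascPochhammer ℝ (n + k + 1)).eval (2 * x)) else 0

theorem kernel_of_lt {x : ℝ} {n k : ℕ} (h : n < k) : kernel x n k = 0 := by
  simp [kernel, h]

theorem kernel_nonneg {x : ℝ} (hx : 0 < x) (n k : ℕ) : 0 ≤ kernel x n k := by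
  have h := ascPochhammer_pos (n + k + 1) (2 * x) (by positivity)
  unfold kernel
  split_ifs <;> positivity

/-- Recurrence in the first variable; in this form it also holds for `k > n`. -/
theorem kernel_succ_left {x : ℝ} (hx : 0 < x) (n k : ℕ) :
    kernel x (n + 1) k * ((n + 1 + x) ^ 2 - (k + x) ^ 2) = kernel x n k * (n + 1 + x) ^ 2 := by
  rcases lt_trichotomy k (n + 1) with h | rfl | h
  · obtain ⟨m, rfl⟩ := Nat.exists_eq_add_of_le (Nat.lt_succ_iff.1 h)
    have h1 := ascPochhammer_pos (k + m + k + 1) (2 * x) (by positivity)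
    have e1 : k + m + 1 - k = m + 1 := by omega
    have e2 : k + m + 1 + k + 1 = k + m + k + 1 + 1 := by omega
    simp only [kernel, if_pos (show k ≤ k + m + 1 by omega), if_pos (show k ≤ k + m by omega),
      e1, e2, Nat.add_sub_cancel_left, Nat.factorial_succ]
    rw [ascPochhammer_succ_eval (k + m + 1), ascPochhammer_succ_eval (k + m + k + 1)]
    push_cast
    have h2 : (0 : ℝ) < 2 * x + (k + m + k + 1) := by positivity
    field_simp
    ring
  · rw [kernel_of_lt (show n < n + 1 by omega)]
    push_cast
    ring
  · rw [kernel_of_lt h, kernel_of_lt (show n < k by omega)]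
    ring

/-- Recurrence in the second variable; in this form it also holds for `k ≥ n`. -/
theorem kernel_succ_right {x : ℝ} (hx : 0 < x) (n k : ℕ) :
    kernel x n (k + 1) * (n + k + 1 + 2 * x) = kernel x n k * (n - k) := by
  rcases lt_trichotomy k n with h | rfl | h
  · obtain ⟨m, rfl⟩ := Nat.exists_eq_add_of_lt h
    have h1 := ascPochhammer_pos (k + m + 1 + k + 1) (2 * x) (by positivity)
    have e1 : k + m + 1 - k = m + 1 := by omega
    have e2 : k + m + 1 - (k + 1) = m := by omega
    have e3 : k + m + 1 + (k + 1) + 1 = k + m + 1 + k + 1 + 1 := by omega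
    simp only [kernel, if_pos (show k + 1 ≤ k + m + 1 by omega),
      if_pos (show k ≤ k + m + 1 by omega), e1, e2, e3, Nat.factorial_succ]
    rw [ascPochhammer_succ_eval (k + m + 1 + k + 1)]
    push_cast
    have h2 : (0 : ℝ) < 2 * x + (k + m + 1 + k + 1) := by positivity
    field_simp
    ring
  · rw [kernel_of_lt (show k < k + 1 by omega)]
    ring
  · rw [kernel_of_lt h, kernel_of_lt (show n < k + 1 by omega)]
    ring

theorem kernel_antitone {x : ℝ} (hx : 0 < x) (n : ℕ) : Antitone (kernel x n) := by
  refine antitone_nat_of_succ_le fun k => ?_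
  have h := kernel_succ_right hx n k
  have h0 := kernel_nonneg hx n k
  have hp : (0 : ℝ) < n + k + 1 + 2 * x := by positivity
  refine le_of_mul_le_mul_right ?_ hp
  rw [h]
  exact mul_le_mul_of_nonneg_left (by linarith [(Nat.cast_nonneg k : (0 : ℝ) ≤ k)]) h0

theorem ascPochhammer_eval_eq_prod (x : ℝ) (n : ℕ) :
    (ascPochhammer ℝ n).eval x = ∏ j ∈ Finset.range n, (x + j) := by
  induction n with
  | zero => simp
  | succ n ih => rw [ascPochhammer_succ_eval, Finset.prod_range_succ, ih]

theorem tendsto_kernel {x : ℝ} (hx : 0 < x) (k : ℕ) :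
    Tendsto (fun n => kernel x n k) atTop (𝓝 (1 / ProbabilityTheory.beta x x)) := by
  induction k with
  | zero =>
    -- `K(n, 0)` is exactly a quotient of Euler's approximations `n^x n! / (x)_{n+1}` of `Γ(x)`.
    have hlim : Tendsto (fun n => Real.GammaSeq (2 * x) n / Real.GammaSeq x n ^ 2) atTop
        (𝓝 (1 / ProbabilityTheory.beta x x)) := by
      have h := (Real.GammaSeq_tendsto_Gamma (2 * x)).div
        ((Real.GammaSeq_tendsto_Gamma x).pow 2) (pow_ne_zero 2 (Real.Gamma_pos_of_pos hx).ne')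
      have hb : 1 / ProbabilityTheory.beta x x = Real.Gamma (2 * x) / Real.Gamma x ^ 2 := by
        rw [ProbabilityTheory.beta, one_div_div, ← two_mul, ← sq]
      rw [hb]
      exact h
    refine hlim.congr' ?_
    filter_upwards [eventually_gt_atTop 0] with n hn
    have hn' : (0 : ℝ) < n := by exact_mod_cast hn
    have h1 := ascPochhammer_pos (n + 1) (2 * x) (by positivity)
    have h2 := ascPochhammer_pos (n + 1) x hx
    have h3 : (n : ℝ) ^ (2 * x) = ((n : ℝ) ^ x) ^ 2 := by
      rw [mul_comm, Real.rpow_mul hn'.le, Real.rpow_two]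
    have h4 : (0 : ℝ) < (n : ℝ) ^ x := Real.rpow_pos_of_pos hn' x
    simp only [Real.GammaSeq, kernel, ← ascPochhammer_eval_eq_prod, h3]
    simp
    field_simp
  | succ k ih =>
    have hq : Tendsto (fun n : ℕ => ((n : ℝ) - k) / (n + k + 1 + 2 * x)) atTop (𝓝 1) := by
      have h : Tendsto (fun n : ℕ => 1 - (2 * k + 1 + 2 * x) / ((n : ℝ) + (k + 1 + 2 * x)))
          atTop (𝓝 (1 - 0)) :=
        tendsto_const_nhds.sub (tendsto_const_nhds.div_atTop
          (tendsto_atTop_add_const_right _ _ tendsto_natCast_atTop_atTop))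
      rw [sub_zero] at h
      refine h.congr fun n => ?_
      have hp : (0 : ℝ) < n + k + 1 + 2 * x := by positivity
      have hp' : (0 : ℝ) < n + (k + 1 + 2 * x) := by positivity
      field_simp
      ring
    have h := ih.mul hq
    rw [mul_one] at h
    refine h.congr fun n => ?_
    have hp : (0 : ℝ) < n + k + 1 + 2 * x := by positivity
    rw [← mul_div_assoc, div_eq_iff hp.ne', kernel_succ_right hx]

/-! ### Kernel transforms -/

/-- The kernel transform `n ↦ ∑_{k ≤ n} (-1)^k K(n, k) f(k)` of a sequence. -/
def kernelSum (x : ℝ) (f : ℕ → ℝ) (n : ℕ) : ℝ :=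
  ∑ k ∈ Finset.range (n + 1), (-1) ^ k * kernel x n k * f k

theorem kernelSum_const_mul (x c : ℝ) (f : ℕ → ℝ) (n : ℕ) :
    kernelSum x (fun k => c * f k) n = c * kernelSum x f n := by
  simp only [kernelSum, Finset.mul_sum]
  exact Finset.sum_congr rfl fun k _ => by ring

/-- The increment in `n` of a kernel transform, from `K(n,k) - K(n-1,k) = K(n,k) (k+x)²/(n+x)²`. -/
theorem kernelSum_succ {x : ℝ} (hx : 0 < x) (f : ℕ → ℝ) (n : ℕ) :
    kernelSum x f (n + 1) = kernelSum x f n +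
      kernelSum x (fun k => (k + x) ^ 2 * f k) (n + 1) / (n + 1 + x) ^ 2 := by
  have h0 : kernelSum x f n
      = ∑ k ∈ Finset.range (n + 1 + 1), (-1) ^ k * kernel x n k * f k := by
    rw [Finset.sum_range_succ, kernel_of_lt (Nat.lt_succ_self n)]
    simp [kernelSum]
  rw [h0, kernelSum, kernelSum, Finset.sum_div, ← Finset.sum_add_distrib]
  refine Finset.sum_congr rfl fun k _ => ?_
  have hp : (0 : ℝ) < n + 1 + x := by positivity
  have h := kernel_succ_left hx n k
  field_simp
  linear_combination (f k) * h

/-- Prefixing a `2`: summing a kernel transform against `1/(m+x)²` divides the transformed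
sequence by `(k+x)²`. -/
theorem sum_kernelSum_div_sq {x : ℝ} (hx : 0 < x) (f : ℕ → ℝ) (n : ℕ) :
    ∑ m ∈ Finset.range (n + 1), kernelSum x f m / (m + x) ^ 2
      = kernelSum x (fun k => f k / (k + x) ^ 2) n := by
  induction n with
  | zero => simp [kernelSum]; ring
  | succ n ih =>
    rw [Finset.sum_range_succ, ih, kernelSum_succ hx (fun k => f k / (k + x) ^ 2)]
    have h : (fun k : ℕ => ((k : ℝ) + x) ^ 2 * (f k / (k + x) ^ 2)) = f := by
      funext k
      have hp : (0 : ℝ) < k + x := by positivity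
      field_simp
    rw [h]
    push_cast
    rfl

/-- Summation up to `k` with half weight on the endpoint: `h(k)/2 + ∑_{j<k} h(j)`. -/
def halfSum (h : ℕ → ℝ) (k : ℕ) : ℝ :=
  1 / 2 * h k + ∑ j ∈ Finset.range k, h j

/-- Raising an exponent outside the transform: dividing a kernel transform by `n+x` amounts to
applying `2 halfSum` to the transformed sequence divided by `k+x`; here `f` is that quotient. -/
theorem kernelSum_eq_mul_kernelSum_halfSum {x : ℝ} (hx : 0 < x) (f : ℕ → ℝ) (n : ℕ) :
    kernelSum x (fun k => (k + x) * f k) n = (n + x) * (2 * kernelSum x (halfSum f) n) := by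
  -- The difference of both sides telescopes; the boundary factor `m - n` vanishes at `m = n`.
  have key : ∀ m : ℕ, ∑ k ∈ Finset.range (m + 1), ((-1) ^ k * kernel x n k * ((k + x) * f k)
      - (n + x) * (2 * ((-1) ^ k * kernel x n k * halfSum f k)))
      = (-1) ^ m * kernel x n m * (m - n) * ∑ j ∈ Finset.range (m + 1), f j := by
    intro m
    induction m with
    | zero => simp [halfSum]; ring
    | succ m ih =>
      rw [Finset.sum_range_succ, ih, halfSum, Finset.sum_range_succ _ (m + 1)]
      have h := kernel_succ_right hx n m
      push_cast
      rw [pow_succ]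
      linear_combination (-1) ^ m * (∑ j ∈ Finset.range (m + 1), f j) * h
  have h := key n
  rw [sub_self, mul_zero, zero_mul, Finset.sum_sub_distrib, ← Finset.mul_sum,
    ← Finset.mul_sum] at h
  exact sub_eq_zero.1 h

/-- The constant `1`, the truncated star value of the empty index, as a kernel transform. -/
theorem kernelSum_weight {x : ℝ} (hx : 0 < x) (n : ℕ) :
    kernelSum x (fun k => (ascPochhammer ℝ k).eval (2 * x) / k.factorial / (k + x)) n
      = 1 / 2 := by
  induction n with
  | zero =>
    simp [kernelSum, kernel]
    field_simp
  | succ n ih =>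
    rw [kernelSum_succ hx, ih]
    -- The increment vanishes: the alternating sum has an explicit hypergeometric antidifference,
    -- which is zero at both ends.
    have key : ∀ m : ℕ, 2 * ((n : ℝ) + 1) * ∑ k ∈ Finset.range m,
        ((-1) ^ k * kernel x (n + 1) k * (((k : ℝ) + x) ^ 2 *
          ((ascPochhammer ℝ k).eval (2 * x) / k.factorial / (k + x))))
        = -((-1) ^ m * kernel x (n + 1) m * ((ascPochhammer ℝ m).eval (2 * x) / m.factorial)
          * (m * (n + 1 + m + 2 * x))) := by
      intro m
      induction m with
      | zero => simp
      | succ m ihm =>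
        rw [Finset.sum_range_succ, mul_add, ihm, ascPochhammer_succ_eval, Nat.factorial_succ,
          pow_succ]
        have h := kernel_succ_right hx (n + 1) m
        have hp : (0 : ℝ) < m + x := by positivity
        push_cast at h ⊢
        field_simp
        linear_combination (-(-1) ^ m * (ascPochhammer ℝ m).eval (2 * x) * (2 * x + m)) * h
    have h := key (n + 1 + 1)
    rw [kernel_of_lt (Nat.lt_succ_self (n + 1))] at h
    have h2 : (2 * ((n : ℝ) + 1)) ≠ 0 := by positivity
    have h3 : kernelSum x (fun k : ℕ => ((k : ℝ) + x) ^ 2 *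
        ((ascPochhammer ℝ k).eval (2 * x) / k.factorial / (k + x))) (n + 1) = 0 := by
      refine (mul_eq_zero.1 (?_ : 2 * ((n : ℝ) + 1) * _ = 0)).resolve_left h2
      rw [kernelSum, h]
      ring
    rw [h3]
    simp

/-! ### Passage to the limit -/

/-- The kernel is a regular summation method up to the factor `1 / B(x, x)`: it evaluates a
convergent series to its sum. -/
theorem tendsto_sum_kernel_mul {x : ℝ} (hx : 0 < x) {u : ℕ → ℝ} {S : ℝ}
    (hu : Tendsto (fun n => ∑ k ∈ Finset.range n, u k) atTop (𝓝 S)) :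
    Tendsto (fun n => ∑ k ∈ Finset.range (n + 1), kernel x n k * u k) atTop
      (𝓝 (1 / ProbabilityTheory.beta x x * S)) := by
  set D : ℕ → ℝ := fun n => ∑ k ∈ Finset.range n, u k - S with hD
  have hDlim : Tendsto D atTop (𝓝 0) := by
    simpa [hD] using hu.sub_const S
  -- Summation by parts against the tails `D`.
  have habel : ∀ n m, ∑ k ∈ Finset.range m, kernel x n k * u k
      = kernel x n m * D m + kernel x n 0 * S
        + ∑ k ∈ Finset.range m, (kernel x n k - kernel x n (k + 1)) * D (k + 1) := by
    intro n m
    induction m with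
    | zero => simp [hD]
    | succ m ih =>
      rw [Finset.sum_range_succ, ih, Finset.sum_range_succ _ m]
      simp only [hD, Finset.sum_range_succ _ m]
      ring
  have hsplit : ∀ n, ∑ k ∈ Finset.range (n + 1), kernel x n k * u k = kernel x n 0 * S
      + ∑ k ∈ Finset.range (n + 1), (kernel x n k - kernel x n (k + 1)) * D (k + 1) := by
    intro n
    rw [habel, kernel_of_lt (Nat.lt_succ_self n)]
    ring
  have hw : ∀ n k, 0 ≤ kernel x n k - kernel x n (k + 1) := fun n k =>
    sub_nonneg.2 (kernel_antitone hx n (Nat.le_succ k))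
  -- The weights `K(n, k) - K(n, k+1)` are nonnegative with bounded total mass, and each of them
  -- tends to `0` with `n`, so they average the null sequence `D` to `0`.
  have herr : Tendsto (fun n => ∑ k ∈ Finset.range (n + 1),
      (kernel x n k - kernel x n (k + 1)) * D (k + 1)) atTop (𝓝 0) := by
    rw [Metric.tendsto_atTop']
    intro ε hε
    set L := 1 / ProbabilityTheory.beta x x
    have hL : 0 < L + 1 := by
      have : 0 ≤ L := ge_of_tendsto' (tendsto_kernel hx 0) fun n => kernel_nonneg hx n 0
      linarith
    set δ := ε / (2 * (L + 1)) with hδ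
    have hδ0 : 0 < δ := by positivity
    obtain ⟨M, hM⟩ := (Metric.tendsto_atTop.1 hDlim) δ hδ0
    have hfix : Tendsto (fun n => ∑ k ∈ Finset.range M,
        (kernel x n k - kernel x n (k + 1)) * |D (k + 1)|) atTop (𝓝 0) := by
      have h : Tendsto (fun n => ∑ k ∈ Finset.range M,
          (kernel x n k - kernel x n (k + 1)) * |D (k + 1)|) atTop
          (𝓝 (∑ k ∈ Finset.range M, (L - L) * |D (k + 1)|)) :=
        tendsto_finsetSum _ fun k _ =>
          ((tendsto_kernel hx k).sub (tendsto_kernel hx (k + 1))).mul_const _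
      simpa using h
    have h1 := hfix.eventually_lt_const (half_pos hε)
    have h2 := (tendsto_kernel hx 0).eventually_lt_const (lt_add_one L)
    obtain ⟨n₀, hn₀⟩ := eventually_atTop.1 (h1.and (h2.and (eventually_ge_atTop M)))
    refine ⟨n₀, fun n hn => ?_⟩
    obtain ⟨ha, hb, hc⟩ := hn₀ n hn.le
    rw [Real.dist_eq, sub_zero]
    have htel : ∑ k ∈ Finset.Ico M (n + 1), (kernel x n k - kernel x n (k + 1)) * δ
        ≤ kernel x n 0 * δ := by
      rw [← Finset.sum_mul]
      refine mul_le_mul_of_nonneg_right ?_ hδ0.le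
      refine (Finset.sum_le_sum_of_subset_of_nonneg (t := Finset.range (n + 1))
        (fun k hk => Finset.mem_range.2 (Finset.mem_Ico.1 hk).2) fun k _ _ => hw n k).trans ?_
      rw [Finset.sum_range_sub']
      linarith [kernel_nonneg hx n (n + 1)]
    have htail : |∑ k ∈ Finset.Ico M (n + 1), (kernel x n k - kernel x n (k + 1)) * D (k + 1)|
        ≤ ∑ k ∈ Finset.Ico M (n + 1), (kernel x n k - kernel x n (k + 1)) * δ := by
      refine (Finset.abs_sum_le_sum_abs _ _).trans (Finset.sum_le_sum fun k hk => ?_)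
      rw [abs_mul, abs_of_nonneg (hw n k)]
      have := hM (k + 1) ((Finset.mem_Ico.1 hk).1.trans (Nat.le_succ k))
      rw [Real.dist_eq, sub_zero] at this
      exact mul_le_mul_of_nonneg_left this.le (hw n k)
    have hhead : |∑ k ∈ Finset.range M, (kernel x n k - kernel x n (k + 1)) * D (k + 1)|
        ≤ ∑ k ∈ Finset.range M, (kernel x n k - kernel x n (k + 1)) * |D (k + 1)| := by
      refine (Finset.abs_sum_le_sum_abs _ _).trans (Finset.sum_le_sum fun k _ => ?_)
      rw [abs_mul, abs_of_nonneg (hw n k)]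
    have hKδ : kernel x n 0 * δ ≤ ε / 2 := by
      refine (mul_le_mul_of_nonneg_right hb.le hδ0.le).trans (le_of_eq ?_)
      rw [hδ]
      field_simp
    rw [← Finset.sum_range_add_sum_Ico _ (show M ≤ n + 1 by omega)]
    linarith [abs_add_le (∑ k ∈ Finset.range M, (kernel x n k - kernel x n (k + 1)) * D (k + 1))
      (∑ k ∈ Finset.Ico M (n + 1), (kernel x n k - kernel x n (k + 1)) * D (k + 1))]
  have h := ((tendsto_kernel hx 0).mul_const S).add herr
  rw [add_zero] at h
  exact h.congr fun n => (hsplit n).symm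

/-! ### Interpolated sums and contractions -/

/-- The weight `(2a/N)_k / k!` attached to the smallest summation variable. -/
def pochWeight (N a k : ℕ) : ℝ :=
  (ascPochhammer ℝ k).eval (2 * (a : ℝ) / N) / (k.factorial : ℝ)

/-- The nested sum over `k ≥ k₁ ≥ k₂ ≥ ⋯ ≥ k_u ≥ 0` attached to an index, in which every
equality sign between neighbouring variables, including `k = k₁`, costs a factor `1/2`. It is the
inner part of a `1/2`-interpolated value whose largest summation variable is `k`. The Pochhammer
weight sits at the smallest variable, which is `k` itself for the empty index. -/
def interpSum (N a : ℕ) : List ℤ → ℕ → ℝ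
  | [], k => pochWeight N a k
  | l :: t, k => halfSum (fun j => tTerm N a l j * interpSum N a t j) k

/-- The summand of `tTildeFin` with respect to the largest summation variable. The value `0` at
the empty index is a convention: contractions of a nonempty index are nonempty. -/
def tTildeSummand (N a : ℕ) : List ℤ → ℕ → ℝ
  | [], _ => 0
  | [s], k => tTerm N a s k * pochWeight N a k
  | s :: s' :: t, k => tTerm N a s k * tTildeFin N a (s' :: t) k

theorem tTildeFin_eq_sum (N a : ℕ) {l : List ℤ} (hl : l ≠ []) (n : ℕ) :
    tTildeFin N a l n = ∑ k ∈ Finset.range n, tTildeSummand N a l k := by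
  match l, hl with
  | [s], _ => rfl
  | s :: s' :: t, _ => rfl

theorem tTildeSummand_cons (N a : ℕ) (s : ℤ) {l : List ℤ} (hl : l ≠ []) (k : ℕ) :
    tTildeSummand N a (s :: l) k = tTerm N a s k * tTildeFin N a l k := by
  match l, hl with
  | s' :: t, _ => rfl

theorem ne_nil_of_mem_contractionsFrom {t : List ℤ} {s : ℤ} {p : ℕ × List ℤ}
    (hp : p ∈ contractionsFrom s t) : p.2 ≠ [] := by
  induction t generalizing s p with
  | nil =>
    rw [contractionsFrom, List.mem_singleton] at hp
    simp [hp]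
  | cons l t ih =>
    rw [contractionsFrom, List.mem_append, List.mem_map, List.mem_map] at hp
    rcases hp with ⟨p', _, rfl⟩ | ⟨p', hp', rfl⟩
    · simp
    · exact ih (p := p') hp'

theorem tTerm_mul_tTerm (N a : ℕ) {s l : ℤ} (hs : s ≠ 0) (hl : l ≠ 0) (k : ℕ) :
    tTerm N a s k * tTerm N a l k = tTerm N a (mergeIndex s l) k := by
  have habs : (mergeIndex s l).natAbs = s.natAbs + l.natAbs := by
    unfold mergeIndex
    split_ifs <;> simp only [Int.abs_eq_natAbs] <;> omega
  have hsign : (mergeIndex s l).sign = s.sign * l.sign := by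
    have hpos : 0 < |s| + |l| := by positivity
    unfold mergeIndex
    rw [← Int.sign_mul]
    split_ifs with h
    · rw [Int.sign_eq_one_of_pos h, Int.sign_eq_one_of_pos hpos]
    · have h' : s * l < 0 := lt_of_le_of_ne (not_lt.1 h) (mul_ne_zero hs hl)
      rw [Int.sign_eq_neg_one_of_neg h', Int.sign_neg, Int.sign_eq_one_of_pos hpos]
  rw [tTerm, tTerm, tTerm, habs, hsign, pow_add, div_mul_div_comm, Int.cast_mul, mul_pow]

theorem mergeIndex_ne_zero {s l : ℤ} (hs : s ≠ 0) : mergeIndex s l ≠ 0 := by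
  have hpos : 0 < |s| + |l| := by positivity
  unfold mergeIndex
  split_ifs <;> omega

theorem sum_map_sum_comm {ι : Type*} (L : List ι) (s : Finset ℕ) (f : ι → ℕ → ℝ) :
    (L.map fun p => ∑ k ∈ s, f p k).sum = ∑ k ∈ s, (L.map fun p => f p k).sum := by
  induction L with
  | nil => simp
  | cons p L ih => simp [ih, Finset.sum_add_distrib]

/-- The weighted sum over all contractions of an index is a nested sum with half weights on the
equality signs. -/
theorem sum_contractionsFrom (N a : ℕ) {t : List ℤ} (ht : ∀ l ∈ t, 0 < l) {s : ℤ} (hs : s ≠ 0)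
    (k : ℕ) :
    ((contractionsFrom s t).map fun p => (1 / 2 : ℝ) ^ p.1 * tTildeSummand N a p.2 k).sum
      = tTerm N a s k * interpSum N a t k := by
  induction t generalizing s k with
  | nil => simp [contractionsFrom, tTildeSummand, interpSum]
  | cons l t ih =>
    have hl : 0 < l := ht l (by simp)
    have ht' : ∀ l ∈ t, 0 < l := fun m hm => ht m (by simp [hm])
    have h1 : ((contractionsFrom l t).map
        fun p => (1 / 2 : ℝ) ^ p.1 * tTildeSummand N a (s :: p.2) k).sum
        = tTerm N a s k * ∑ j ∈ Finset.range k, tTerm N a l j * interpSum N a t j := by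
      simp only [← ih ht' hl.ne']
      rw [← sum_map_sum_comm, ← List.sum_map_mul_left]
      congr 1
      refine List.map_congr_left fun p hp => ?_
      have hne := ne_nil_of_mem_contractionsFrom hp
      rw [tTildeSummand_cons N a s hne, tTildeFin_eq_sum N a hne, ← Finset.mul_sum]
      ring
    have h2 : ((contractionsFrom (mergeIndex s l) t).map
        fun p => (1 / 2 : ℝ) ^ (p.1 + 1) * tTildeSummand N a p.2 k).sum
        = 1 / 2 * (tTerm N a s k * tTerm N a l k * interpSum N a t k) := by
      rw [tTerm_mul_tTerm N a hs hl.ne', ← ih ht' (mergeIndex_ne_zero hs), ← List.sum_map_mul_left]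
      congr 1
      refine List.map_congr_left fun p _ => ?_
      ring
    rw [contractionsFrom, List.map_append, List.sum_append, List.map_map, List.map_map]
    simp only [Function.comp_def]
    rw [h1, h2, interpSum, halfSum]
    ring

/-! ### Bounds and absolute convergence -/

theorem add_one_le_den {N a : ℕ} (ha : 1 ≤ a) (haN : a ≤ N) (k : ℕ) :
    (k : ℝ) + 1 ≤ (N : ℝ) * k + a := by
  have hN : 1 ≤ N := ha.trans haN
  have h : k + 1 ≤ N * k + a := by nlinarith
  exact_mod_cast h

theorem den_pos {N a : ℕ} (ha : 1 ≤ a) (haN : a ≤ N) (k : ℕ) : (0 : ℝ) < (N : ℝ) * k + a :=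
  lt_of_lt_of_le (by positivity) (add_one_le_den ha haN k)

theorem tTerm_of_pos {N a : ℕ} {l : ℤ} (hl : 0 < l) (k : ℕ) :
    tTerm N a l k = 1 / ((N : ℝ) * k + a) ^ l.natAbs := by
  rw [tTerm, Int.sign_eq_one_of_pos hl]
  simp

theorem tTerm_neg {N a : ℕ} {l : ℤ} (hl : 0 < l) (k : ℕ) :
    tTerm N a (-l) k = (-1) ^ k * tTerm N a l k := by
  rw [tTerm, tTerm, Int.sign_neg, Int.sign_eq_one_of_pos hl, Int.natAbs_neg]
  simp [div_eq_mul_inv]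

theorem tTerm_nonneg {N a : ℕ} {l : ℤ} (hl : 0 < l) (k : ℕ) : 0 ≤ tTerm N a l k := by
  rw [tTerm_of_pos hl]
  positivity

theorem tTerm_le {N a : ℕ} (ha : 1 ≤ a) (haN : a ≤ N) {l : ℤ} {m : ℕ} (hm : 1 ≤ m)
    (hl : (m : ℤ) ≤ l) (k : ℕ) : tTerm N a l k ≤ 1 / ((k : ℝ) + 1) ^ m := by
  have h := add_one_le_den ha haN k
  rw [tTerm_of_pos (by omega)]
  refine one_div_le_one_div_of_le (by positivity) ?_
  calc ((k : ℝ) + 1) ^ m ≤ ((k : ℝ) + 1) ^ l.natAbs :=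
        pow_le_pow_right₀ (by linarith [(Nat.cast_nonneg k : (0 : ℝ) ≤ k)]) (by omega)
    _ ≤ _ := pow_le_pow_left₀ (by positivity) h _

theorem pochWeight_pos {N a : ℕ} (ha : 1 ≤ a) (haN : a ≤ N) (k : ℕ) : 0 < pochWeight N a k := by
  have hN : (0 : ℝ) < N := by exact_mod_cast ha.trans haN
  have ha' : (0 : ℝ) < a := by exact_mod_cast ha
  have h := ascPochhammer_pos k (2 * (a : ℝ) / N) (by positivity)
  unfold pochWeight
  positivity

theorem pochWeight_succ (N a k : ℕ) :
    pochWeight N a (k + 1) = pochWeight N a k * ((2 * (a : ℝ) / N + k) / (k + 1)) := by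
  rw [pochWeight, pochWeight, ascPochhammer_succ_eval, Nat.factorial_succ]
  push_cast
  field_simp

theorem pochWeight_le {N a : ℕ} (ha : 1 ≤ a) (haN : a ≤ N) (k : ℕ) :
    pochWeight N a k ≤ k + 1 := by
  have hN : (0 : ℝ) < N := by exact_mod_cast ha.trans haN
  have hy : 2 * (a : ℝ) / N ≤ 2 := by
    rw [div_le_iff₀ hN]
    have : (a : ℝ) ≤ N := by exact_mod_cast haN
    linarith
  induction k with
  | zero => simp [pochWeight]
  | succ k ih =>
    rw [pochWeight_succ]
    push_cast
    calc pochWeight N a k * ((2 * (a : ℝ) / N + k) / (k + 1))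
        ≤ (k + 1) * ((2 + k) / (k + 1)) := by gcongr
      _ = k + 1 + 1 := by field_simp; ring

theorem interpSum_nonneg {N a : ℕ} (ha : 1 ≤ a) (haN : a ≤ N) {t : List ℤ}
    (ht : ∀ l ∈ t, 0 < l) (k : ℕ) : 0 ≤ interpSum N a t k := by
  induction t generalizing k with
  | nil => exact (pochWeight_pos ha haN k).le
  | cons l t ih =>
    have h : ∀ j, 0 ≤ tTerm N a l j * interpSum N a t j := fun j =>
      mul_nonneg (tTerm_nonneg (ht l (by simp)) j) (ih (fun m hm => ht m (by simp [hm])) j)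
    exact add_nonneg (mul_nonneg (by norm_num) (h k)) (Finset.sum_nonneg fun j _ => h j)

/-- Each contraction is dominated by the whole interpolated sum, whose terms have equal sign. -/
theorem abs_tTildeSummand_le {N a : ℕ} (ha : 1 ≤ a) (haN : a ≤ N) {t : List ℤ}
    (ht : ∀ l ∈ t, 0 < l) {s : ℤ} (hs : s ≠ 0) {p : ℕ × List ℤ} (hp : p ∈ contractionsFrom s t)
    (k : ℕ) :
    |tTildeSummand N a p.2 k| ≤ 2 ^ p.1 * (|tTerm N a s k| * interpSum N a t k) := by
  induction t generalizing s p k with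
  | nil =>
    rw [contractionsFrom, List.mem_singleton] at hp
    subst hp
    simp [tTildeSummand, interpSum, abs_mul, abs_of_pos (pochWeight_pos ha haN k)]
  | cons l t ih =>
    have hl : 0 < l := ht l (by simp)
    have ht' : ∀ l ∈ t, 0 < l := fun m hm => ht m (by simp [hm])
    have hterm : ∀ j, 0 ≤ tTerm N a l j * interpSum N a t j := fun j =>
      mul_nonneg (tTerm_nonneg hl j) (interpSum_nonneg ha haN ht' j)
    rw [contractionsFrom, List.mem_append, List.mem_map, List.mem_map] at hp
    rcases hp with ⟨p', hp', rfl⟩ | ⟨p', hp', rfl⟩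
    · have hne := ne_nil_of_mem_contractionsFrom hp'
      rw [tTildeSummand_cons N a s hne, abs_mul, mul_left_comm, tTildeFin_eq_sum N a hne]
      refine mul_le_mul_of_nonneg_left ?_ (abs_nonneg _)
      calc |∑ j ∈ Finset.range k, tTildeSummand N a p'.2 j|
          ≤ ∑ j ∈ Finset.range k, 2 ^ p'.1 * (tTerm N a l j * interpSum N a t j) := by
            refine (Finset.abs_sum_le_sum_abs _ _).trans (Finset.sum_le_sum fun j _ => ?_)
            have h := ih ht' hl.ne' hp' j
            rwa [abs_of_nonneg (tTerm_nonneg hl j)] at h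
        _ ≤ 2 ^ p'.1 * interpSum N a (l :: t) k := by
            rw [← Finset.mul_sum, interpSum, halfSum]
            refine mul_le_mul_of_nonneg_left ?_ (by positivity)
            linarith [hterm k]
    · have h := ih ht' (mergeIndex_ne_zero hs) hp' k
      rw [← tTerm_mul_tTerm N a hs hl.ne', abs_mul, abs_of_nonneg (tTerm_nonneg hl k)] at h
      refine h.trans ?_
      have hle : tTerm N a l k * interpSum N a t k ≤ 2 * interpSum N a (l :: t) k := by
        rw [interpSum, halfSum]
        linarith [Finset.sum_nonneg fun j (_ : j ∈ Finset.range k) => hterm j]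
      calc 2 ^ p'.1 * (|tTerm N a s k| * tTerm N a l k * interpSum N a t k)
          = 2 ^ p'.1 * |tTerm N a s k| * (tTerm N a l k * interpSum N a t k) := by ring
        _ ≤ 2 ^ p'.1 * |tTerm N a s k| * (2 * interpSum N a (l :: t) k) :=
            mul_le_mul_of_nonneg_left hle (by positivity)
        _ = _ := by ring

theorem sum_one_div_sqrt_le (k : ℕ) :
    ∑ j ∈ Finset.range (k + 1), 1 / √((j : ℝ) + 1) ≤ 2 * √((k : ℝ) + 1) := by
  induction k with
  | zero => simp
  | succ k ih =>
    rw [Finset.sum_range_succ]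
    refine (add_le_add_left ih _).trans ?_
    push_cast
    have h1 : 0 < √((k : ℝ) + 1 + 1) := Real.sqrt_pos.2 (by positivity)
    have h0 : 0 ≤ √((k : ℝ) + 1) := Real.sqrt_nonneg _
    have e1 : √((k : ℝ) + 1 + 1) ^ 2 = k + 1 + 1 := Real.sq_sqrt (by positivity)
    have e0 : √((k : ℝ) + 1) ^ 2 = k + 1 := Real.sq_sqrt (by positivity)
    rw [← sub_nonneg]
    have e : 2 * √((k : ℝ) + 1 + 1) - (2 * √((k : ℝ) + 1) + 1 / √((k : ℝ) + 1 + 1))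
        = (√((k : ℝ) + 1 + 1) - √((k : ℝ) + 1)) ^ 2 / √((k : ℝ) + 1 + 1) := by
      field_simp
      linear_combination e1 - e0
    rw [e]
    positivity

theorem halfSum_le_sum {h : ℕ → ℝ} (hh : ∀ j, 0 ≤ h j) (k : ℕ) :
    halfSum h k ≤ ∑ j ∈ Finset.range (k + 1), h j := by
  rw [halfSum, Finset.sum_range_succ]
  linarith [hh k]

/-- Growth of the inner nested sums. They are in fact bounded by powers of logarithms; the bound
by a square root suffices for convergence and is preserved under prepending an entry. -/
theorem interpSum_le {N a : ℕ} (ha : 1 ≤ a) (haN : a ≤ N) {t : List ℤ} (hne : t ≠ [])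
    (ht : ∀ l ∈ t, 0 < l) (hlast : 2 ≤ t.getLast hne) (k : ℕ) :
    interpSum N a t k ≤ 2 ^ t.length * √((k : ℝ) + 1) := by
  induction t generalizing k with
  | nil => exact absurd rfl hne
  | cons l t ih =>
    have hl : 0 < l := ht l (by simp)
    have ht' : ∀ l ∈ t, 0 < l := fun m hm => ht m (by simp [hm])
    have hterm : ∀ j, 0 ≤ tTerm N a l j * interpSum N a t j := fun j =>
      mul_nonneg (tTerm_nonneg hl j) (interpSum_nonneg ha haN ht' j)
    have hbound : ∀ j, tTerm N a l j * interpSum N a t j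
        ≤ 2 ^ t.length * (1 / √((j : ℝ) + 1)) := by
      intro j
      have hs : 0 < √((j : ℝ) + 1) := Real.sqrt_pos.2 (by positivity)
      have e : √((j : ℝ) + 1) ^ 2 = j + 1 := Real.sq_sqrt (by positivity)
      rcases eq_or_ne t [] with rfl | hne'
      · have h2 : (2 : ℤ) ≤ l := by simpa using hlast
        have hs1 : 1 ≤ √((j : ℝ) + 1) := Real.one_le_sqrt.2 (by simp)
        calc tTerm N a l j * interpSum N a [] j ≤ 1 / ((j : ℝ) + 1) ^ 2 * (j + 1) :=
              mul_le_mul (tTerm_le ha haN one_le_two h2 j) (pochWeight_le ha haN j)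
                (pochWeight_pos ha haN j).le (by positivity)
          _ = 1 / √((j : ℝ) + 1) ^ 2 := by rw [e]; field_simp
          _ ≤ 1 / √((j : ℝ) + 1) := by
              refine one_div_le_one_div_of_le hs ?_
              nlinarith
          _ = _ := by simp
      · have h := ih hne' ht' (by rwa [List.getLast_cons hne'] at hlast) j
        calc tTerm N a l j * interpSum N a t j
            ≤ 1 / ((j : ℝ) + 1) ^ 1 * (2 ^ t.length * √((j : ℝ) + 1)) :=
              mul_le_mul (tTerm_le ha haN le_rfl (by exact_mod_cast hl) j) h
                (interpSum_nonneg ha haN ht' j) (by positivity)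
          _ = _ := by
              rw [pow_one]
              field_simp
              exact e
    calc interpSum N a (l :: t) k
        ≤ ∑ j ∈ Finset.range (k + 1), tTerm N a l j * interpSum N a t j := halfSum_le_sum hterm k
      _ ≤ 2 ^ t.length * ∑ j ∈ Finset.range (k + 1), 1 / √((j : ℝ) + 1) := by
          rw [Finset.mul_sum]
          exact Finset.sum_le_sum fun j _ => hbound j
      _ ≤ 2 ^ t.length * (2 * √((k : ℝ) + 1)) :=
          mul_le_mul_of_nonneg_left (sum_one_div_sqrt_le k) (by positivity)
      _ = _ := by rw [List.length_cons, pow_succ]; ring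

theorem summable_tTerm_mul_interpSum {N a : ℕ} (ha : 1 ≤ a) (haN : a ≤ N) {s : ℤ} (hs : 2 ≤ s)
    {t : List ℤ} (hne : t ≠ []) (ht : ∀ l ∈ t, 0 < l) (hlast : 2 ≤ t.getLast hne) :
    Summable fun k => tTerm N a s k * interpSum N a t k := by
  have hsum : Summable fun k : ℕ => 2 ^ t.length * (1 / ((k : ℝ) + 1) ^ (3 / 2 : ℝ)) := by
    refine Summable.mul_left _ ?_
    have h := (summable_nat_add_iff 1).2
      (Real.summable_one_div_nat_rpow.2 (show (1 : ℝ) < 3 / 2 by norm_num))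
    simpa using h
  refine Summable.of_nonneg_of_le (fun k => mul_nonneg (tTerm_nonneg (by omega) k)
    (interpSum_nonneg ha haN ht k)) (fun k => ?_) hsum
  have hk : (0 : ℝ) < (k : ℝ) + 1 := by positivity
  calc tTerm N a s k * interpSum N a t k
      ≤ 1 / ((k : ℝ) + 1) ^ 2 * (2 ^ t.length * √((k : ℝ) + 1)) :=
        mul_le_mul (tTerm_le ha haN one_le_two hs k) (interpSum_le ha haN hne ht hlast k)
          (interpSum_nonneg ha haN ht k) (by positivity)
    _ = _ := by
        have e : ((k : ℝ) + 1) ^ 2 = ((k : ℝ) + 1) ^ (3 / 2 : ℝ) * √((k : ℝ) + 1) := by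
          rw [Real.sqrt_eq_rpow, ← Real.rpow_add hk, ← Real.rpow_two]
          norm_num
        have h1 : 0 < √((k : ℝ) + 1) := Real.sqrt_pos.2 hk
        have h2 : 0 < ((k : ℝ) + 1) ^ (3 / 2 : ℝ) := Real.rpow_pos_of_pos hk _
        rw [e]
        field_simp

/-! ### The finite identity -/

theorem den_eq {N : ℕ} (hN : (N : ℝ) ≠ 0) (a k : ℕ) :
    (N : ℝ) * k + a = N * (k + (a : ℝ) / N) := by
  field_simp

theorem sum_one_div_sq_mul_kernelSum {N a : ℕ} (ha : 1 ≤ a) (haN : a ≤ N) (f : ℕ → ℝ) (n : ℕ) :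
    ∑ m ∈ Finset.range (n + 1), 1 / ((N : ℝ) * m + a) ^ 2 * kernelSum ((a : ℝ) / N) f m
      = kernelSum ((a : ℝ) / N) (fun k => 1 / ((N : ℝ) * k + a) ^ 2 * f k) n := by
  have hN : (0 : ℝ) < N := by exact_mod_cast ha.trans haN
  have hx : 0 < (a : ℝ) / N := div_pos (by exact_mod_cast ha) hN
  have h := sum_kernelSum_div_sq hx (fun k => 1 / (N : ℝ) ^ 2 * f k) n
  simp only [kernelSum_const_mul] at h
  simp only [den_eq hN.ne', mul_pow, one_div, mul_inv]
  simp only [one_div] at h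
  calc _ = _ := Finset.sum_congr rfl fun m _ => by ring
    _ = _ := h
    _ = _ := by
      congr 1
      funext k
      ring

theorem one_div_mul_kernelSum {N a : ℕ} (ha : 1 ≤ a) (haN : a ≤ N) (f : ℕ → ℝ) (n : ℕ) :
    1 / ((N : ℝ) * n + a) * kernelSum ((a : ℝ) / N) f n
      = 2 * kernelSum ((a : ℝ) / N) (halfSum fun k => 1 / ((N : ℝ) * k + a) * f k) n := by
  have hN : (0 : ℝ) < N := by exact_mod_cast ha.trans haN
  have hx : 0 < (a : ℝ) / N := div_pos (by exact_mod_cast ha) hN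
  have h := kernelSum_eq_mul_kernelSum_halfSum hx (fun k => 1 / ((N : ℝ) * k + a) * f k) n
  have hf : (fun k : ℕ => ((k : ℝ) + (a : ℝ) / N) * (1 / ((N : ℝ) * k + a) * f k))
      = fun k => 1 / (N : ℝ) * f k := by
    funext k
    have hk := den_pos ha haN k
    rw [den_eq hN.ne'] at hk ⊢
    have : (0 : ℝ) < k + (a : ℝ) / N := by positivity
    field_simp
  have hn := den_pos ha haN n
  rw [hf, kernelSum_const_mul] at h
  rw [one_div_mul_eq_div, div_eq_iff hn.ne', den_eq hN.ne' a n]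
  field_simp at h ⊢
  linear_combination h

/-- Prepending entries `1` to the inner index. -/
theorem one_div_pow_mul_kernelSum_interpSum {N a : ℕ} (ha : 1 ≤ a) (haN : a ≤ N) (t : List ℤ)
    (m n : ℕ) :
    1 / ((N : ℝ) * n + a) ^ m * kernelSum ((a : ℝ) / N) (interpSum N a t) n
      = 2 ^ m * kernelSum ((a : ℝ) / N) (interpSum N a (List.replicate m 1 ++ t)) n := by
  induction m with
  | zero => simp
  | succ m ih =>
    have h1 : interpSum N a (List.replicate (m + 1) 1 ++ t) = halfSum fun k =>
        1 / ((N : ℝ) * k + a) * interpSum N a (List.replicate m 1 ++ t) k := by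
      funext k
      rw [List.replicate_succ, List.cons_append, interpSum]
      simp [tTerm_of_pos]
    rw [h1, pow_succ 2, mul_assoc, ← one_div_mul_kernelSum ha haN, mul_left_comm, ← ih]
    field_simp
    ring

theorem tStarFin_replicate_two_append {N a : ℕ} (ha : 1 ≤ a) (haN : a ≤ N) {L : List ℕ} {C : ℝ}
    {f : ℕ → ℝ} (hL : ∀ n, tStarFin N a L n = C * kernelSum ((a : ℝ) / N) f n) (m n : ℕ) :
    tStarFin N a (List.replicate m 2 ++ L) n
      = C * kernelSum ((a : ℝ) / N) (fun k => 1 / ((N : ℝ) * k + a) ^ (2 * m) * f k) n := by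
  induction m generalizing n with
  | zero => simp [hL]
  | succ m ih =>
    rw [List.replicate_succ, List.cons_append, tStarFin]
    simp only [ih]
    simp only [mul_left_comm _ C, ← Finset.mul_sum]
    rw [sum_one_div_sq_mul_kernelSum ha haN]
    congr 2
    funext k
    rw [← mul_assoc, one_div_mul_one_div, ← pow_add]
    ring_nf

/-- The absolute value of the first entry of `halfIndex`. -/
def headEntry : (d : ℕ) → (Fin (d + 1) → ℕ) → ℤ
  | 0, b => 2 * (b 0 : ℤ) + 1
  | _ + 1, b => 2 * (b 0 : ℤ) + 2

/-- The entries of `halfIndex` after the first one, read off recursively: removing the first block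
`({2}^{b₀}, c₁)` of the star index removes `{1}^{c₁-3}` and lowers the following entry by one. -/
def tailIndex : (d : ℕ) → (Fin (d + 1) → ℕ) → (Fin d → ℕ) → List ℤ
  | 0, _, _ => []
  | d + 1, b, c => List.replicate (c 0 - 3) 1 ++
      (headEntry d (fun i => b i.succ) + 1) :: tailIndex d (fun i => b i.succ) (fun i => c i.succ)

theorem headEntry_pos (d : ℕ) (b : Fin (d + 1) → ℕ) : 0 < headEntry d b := by
  cases d <;> simp only [headEntry] <;> omega

theorem tailIndex_pos (d : ℕ) (b : Fin (d + 1) → ℕ) (c : Fin d → ℕ) :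
    ∀ l ∈ tailIndex d b c, 0 < l := by
  induction d with
  | zero => simp [tailIndex]
  | succ d ih =>
    intro l hl
    rw [tailIndex, List.mem_append, List.mem_cons] at hl
    rcases hl with h | rfl | h
    · rw [List.eq_of_mem_replicate h]
      exact one_pos
    · linarith [headEntry_pos d fun i => b i.succ]
    · exact ih _ _ l h

theorem two_le_getLast_tailIndex (d : ℕ) (b : Fin (d + 1) → ℕ) (c : Fin d → ℕ)
    (h : tailIndex d b c ≠ []) : 2 ≤ (tailIndex d b c).getLast h := by
  induction d with
  | zero => exact absurd rfl h
  | succ d ih =>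
    simp only [tailIndex]
    rw [List.getLast_append_of_ne_nil _ (List.cons_ne_nil _ _)]
    by_cases h' : tailIndex d (fun i => b i.succ) (fun i => c i.succ) = []
    · simp only [h', List.getLast_singleton]
      linarith [headEntry_pos d fun i => b i.succ]
    · rw [List.getLast_cons h']
      exact ih _ _ h'

theorem halfIndex_eq_cons (d : ℕ) (b : Fin (d + 1) → ℕ) (c : Fin d → ℕ) :
    halfIndex d b c = -headEntry d b :: tailIndex d b c := by
  cases d with
  | zero => rfl
  | succ d =>
    rw [halfIndex, headEntry, List.append_assoc, List.append_assoc, List.singleton_append]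
    congr 1
    induction d with
    | zero => simp [tailIndex, headEntry]; ring
    | succ d ih =>
      have h := ih (fun i => b i.succ) (fun i => c i.succ)
      rw [tailIndex, ← h, headEntry, List.ofFn_succ, List.flatten_cons]
      simp only [List.append_assoc, List.singleton_append]
      congr 2

theorem blocksOfTwos_succ (d : ℕ) (b : Fin (d + 2) → ℕ) (c : Fin (d + 1) → ℕ) :
    blocksOfTwos (d + 1) b c = List.replicate (b 0) 2 ++
      c 0 :: blocksOfTwos d (fun i => b i.succ) (fun i => c i.succ) := by
  simp [blocksOfTwos, List.ofFn_succ]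

/-- The finite form of the identity: the truncated star value is a kernel transform of the
summand of the interpolated value. -/
theorem tStarFin_blocksOfTwos {N a : ℕ} (ha : 1 ≤ a) (haN : a ≤ N) (d : ℕ)
    (b : Fin (d + 1) → ℕ) (c : Fin d → ℕ) (hc : ∀ i, 3 ≤ c i) (n : ℕ) :
    tStarFin N a (blocksOfTwos d b c) n = 2 * N * (∏ i, (2 : ℝ) ^ (c i - 2)) *
      kernelSum ((a : ℝ) / N)
        (fun k => tTerm N a (headEntry d b) k * interpSum N a (tailIndex d b c) k) n := by
  have hN : (0 : ℝ) < N := by exact_mod_cast ha.trans haN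
  have hx : 0 < (a : ℝ) / N := div_pos (by exact_mod_cast ha) hN
  induction d generalizing n with
  | zero =>
    have hnil : ∀ n, tStarFin N a [] n = 2 * N * kernelSum ((a : ℝ) / N)
        (fun k => 1 / ((N : ℝ) * k + a) * pochWeight N a k) n := by
      intro n
      have h := kernelSum_weight hx n
      have hf : (fun k : ℕ => 1 / ((N : ℝ) * k + a) * pochWeight N a k) = fun k =>
          1 / (N : ℝ) * ((ascPochhammer ℝ k).eval (2 * ((a : ℝ) / N)) / k.factorial
            / (k + (a : ℝ) / N)) := by
        funext k
        have hk := den_pos ha haN k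
        rw [den_eq hN.ne'] at hk ⊢
        have : (0 : ℝ) < k + (a : ℝ) / N := by positivity
        rw [pochWeight, mul_div_assoc]
        field_simp
      rw [hf, kernelSum_const_mul, h, tStarFin]
      field_simp
    have h := tStarFin_replicate_two_append ha haN hnil (b 0) n
    simp only [blocksOfTwos, List.ofFn_zero, List.flatten_nil, h, Finset.univ_eq_empty,
      Finset.prod_empty, mul_one]
    congr 2
    funext k
    have he : (headEntry 0 b).natAbs = 2 * b 0 + 1 := by
      simp only [headEntry]
      omega
    rw [tTerm_of_pos (headEntry_pos 0 b), he, pow_succ, ← mul_assoc, one_div_mul_one_div]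
    rfl
  | succ d ih =>
    set b' : Fin (d + 1) → ℕ := fun i => b i.succ with hb'
    set c' : Fin d → ℕ := fun i => c i.succ with hc'
    have ih' := ih b' c' (fun i => hc i.succ)
    set t := tailIndex d b' c' with ht
    set e := headEntry d b' with he
    set C : ℝ := 2 * N * ∏ i, (2 : ℝ) ^ (c' i - 2) with hC
    have he0 : 0 < e := headEntry_pos d b'
    obtain ⟨m, hm⟩ : ∃ m, c 0 = m + 3 := ⟨c 0 - 3, by have := hc 0; omega⟩
    -- Of the exponent `c 0 = m + 3`, all but `2` is absorbed by `m + 1` uses of `halfSum`: the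
    -- first raises the entry `e` to `e + 1`, the others insert the `m` entries `1`.
    have hstep : ∀ n, 1 / ((N : ℝ) * n + a) ^ (m + 1) * kernelSum ((a : ℝ) / N)
        (fun k => tTerm N a e k * interpSum N a t k) n
        = 2 ^ (m + 1) * kernelSum ((a : ℝ) / N) (interpSum N a (tailIndex (d + 1) b c)) n := by
      intro n
      have h1 : interpSum N a ((e + 1) :: t) = halfSum fun k =>
          1 / ((N : ℝ) * k + a) * (tTerm N a e k * interpSum N a t k) := by
        funext k
        have he1 : (e + 1).natAbs = e.natAbs + 1 := by omega
        simp only [interpSum, tTerm_of_pos he0, tTerm_of_pos (show 0 < e + 1 by omega), he1,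
          pow_succ']
        congr 1
        funext j
        rw [← mul_assoc, one_div_mul_one_div]
      have h2 := one_div_pow_mul_kernelSum_interpSum ha haN ((e + 1) :: t) m n
      rw [tailIndex, hm, Nat.add_sub_cancel, pow_succ (2 : ℝ), mul_right_comm, ← h2, h1,
        mul_assoc, mul_comm _ (2 : ℝ), ← one_div_mul_kernelSum ha haN]
      field_simp
      ring
    have hcons : ∀ n, tStarFin N a (c 0 :: blocksOfTwos d b' c') n
        = C * 2 ^ (m + 1) * kernelSum ((a : ℝ) / N)
          (fun k => 1 / ((N : ℝ) * k + a) ^ 2 * interpSum N a (tailIndex (d + 1) b c) k) n := by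
      intro n
      rw [tStarFin, ← sum_one_div_sq_mul_kernelSum ha haN, Finset.mul_sum]
      refine Finset.sum_congr rfl fun k _ => ?_
      have hk := den_pos ha haN k
      have h := hstep k
      rw [ih', hm, show m + 3 = 2 + (m + 1) by ring, pow_add]
      calc _ = C * (1 / ((N : ℝ) * k + a) ^ 2) * (1 / ((N : ℝ) * k + a) ^ (m + 1) *
            kernelSum ((a : ℝ) / N) (fun k => tTerm N a e k * interpSum N a t k) k) := by
              field_simp
        _ = _ := by rw [h]; ring
    rw [blocksOfTwos_succ, tStarFin_replicate_two_append ha haN hcons, Fin.prod_univ_succ, hm,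
      show m + 3 - 2 = m + 1 by omega]
    congr 1
    · rw [hC]
      ring
    · congr 1
      funext k
      have he : (headEntry (d + 1) b).natAbs = 2 * b 0 + 2 := by
        simp only [headEntry]
        omega
      rw [tTerm_of_pos (headEntry_pos (d + 1) b), he, ← mul_assoc, one_div_mul_one_div, ← pow_add]

/-! ### Convergence of the alternating values -/

theorem antitone_pochWeight_div {N a : ℕ} (ha : 1 ≤ a) (haN : a ≤ N) :
    Antitone fun k => pochWeight N a k / ((N : ℝ) * k + a) := by
  refine antitone_nat_of_succ_le fun k => ?_
  have hw := pochWeight_pos ha haN k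
  have h0 := den_pos ha haN k
  have h1 := den_pos ha haN (k + 1)
  have hN : (0 : ℝ) < N := by exact_mod_cast ha.trans haN
  have ha0 : (0 : ℝ) < a := by exact_mod_cast ha
  have haN' : (a : ℝ) ≤ N := by exact_mod_cast haN
  rw [pochWeight_succ, div_le_div_iff₀ h1 h0, mul_assoc]
  refine mul_le_mul_of_nonneg_left ?_ hw.le
  rw [div_mul_eq_mul_div, div_le_iff₀ (by positivity)]
  have e : (2 * (a : ℝ) / N + k) = (2 * a + N * k) / N := by field_simp
  rw [e, div_mul_eq_mul_div, div_le_iff₀ hN]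
  push_cast
  have hk : (0 : ℝ) ≤ N * k := by positivity
  nlinarith [mul_le_mul_of_nonneg_left haN' hk, mul_le_mul haN' haN' ha0.le hN.le,
    mul_le_mul_of_nonneg_left haN' hN.le]

/-- The decay that makes the alternating series of depth one and exponent one converge; it fails
for `a = N`, where the quotient is `1 / N`. -/
theorem tendsto_pochWeight_div {N a : ℕ} (ha : 1 ≤ a) (haN : a < N) :
    Tendsto (fun k => pochWeight N a k / ((N : ℝ) * k + a)) atTop (𝓝 0) := by
  have hN : (0 : ℝ) < N := by exact_mod_cast (Nat.zero_lt_of_lt haN)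
  have ha0 : (0 : ℝ) < a := by exact_mod_cast ha
  set y : ℝ := 2 * (a : ℝ) / N with hy
  have hy0 : 0 < y := by positivity
  have hy2 : 0 < 2 - y := by
    have : (a : ℝ) < N := by exact_mod_cast haN
    rw [sub_pos, hy, div_lt_iff₀ hN]
    linarith
  have hG := (Real.GammaSeq_tendsto_Gamma y).inv₀ (Real.Gamma_pos_of_pos hy0).ne'
  -- The quotient is at most `n^{y-2} / GammaSeq y n`.
  have hpow := (tendsto_rpow_neg_atTop hy2).comp tendsto_natCast_atTop_atTop
  have hlim := hG.mul hpow
  rw [mul_zero] at hlim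
  refine squeeze_zero' (Eventually.of_forall fun k => ?_) ?_ hlim
  · exact div_nonneg (pochWeight_pos ha haN.le k).le (den_pos ha haN.le k).le
  filter_upwards [eventually_gt_atTop 0] with n hn
  have hn' : (0 : ℝ) < n := by exact_mod_cast hn
  have hP := ascPochhammer_pos n y hy0
  have hn1 : (n : ℝ) ^ y = (n : ℝ) ^ (-(2 - y)) * n ^ 2 := by
    rw [← Real.rpow_two, ← Real.rpow_add hn']
    congr 1
    ring
  have hp := Real.rpow_pos_of_pos hn' (-(2 - y))
  have hden := add_one_le_den ha haN.le n
  simp only [Function.comp_apply, Real.GammaSeq, ← ascPochhammer_eval_eq_prod]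
  rw [ascPochhammer_succ_eval, pochWeight, hn1, ← hy]
  calc (ascPochhammer ℝ n).eval y / n.factorial / ((N : ℝ) * n + a)
      ≤ (ascPochhammer ℝ n).eval y / n.factorial / n := by
        gcongr
        linarith
    _ ≤ (ascPochhammer ℝ n).eval y / n.factorial / n * ((y + n) / n) := by
        refine le_mul_of_one_le_right (by positivity) ?_
        rw [one_le_div hn']
        linarith
    _ = _ := by
        field_simp

/-- Convergence in depth one, by the alternating series test. -/
theorem exists_tendsto_tTildeFin_singleton {N a : ℕ} (ha : 1 ≤ a) (haN : a ≤ N) (m : ℕ)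
    (hedge : m = 0 → a < N) :
    ∃ x : ℝ, Tendsto (tTildeFin N a [-(2 * (m : ℤ) + 1)]) atTop (𝓝 x) := by
  set g : ℕ → ℝ := fun k => 1 / ((N : ℝ) * k + a) ^ (2 * m) *
    (pochWeight N a k / ((N : ℝ) * k + a)) with hg
  have hq : ∀ k, 0 ≤ pochWeight N a k / ((N : ℝ) * k + a) := fun k =>
    div_nonneg (pochWeight_pos ha haN k).le (den_pos ha haN k).le
  have hanti : Antitone g := by
    intro i j hij
    refine mul_le_mul ?_ (antitone_pochWeight_div ha haN hij) (hq j) ?_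
    · have := den_pos ha haN i
      refine one_div_le_one_div_of_le (by positivity) ?_
      gcongr
    · have := den_pos ha haN i
      positivity
  have hzero : Tendsto g atTop (𝓝 0) := by
    rcases Nat.eq_zero_or_pos m with rfl | hm
    · simpa [hg] using tendsto_pochWeight_div ha (hedge rfl)
    · refine squeeze_zero (fun k => ?_) (fun k => ?_) tendsto_one_div_add_atTop_nhds_zero_nat
      · exact mul_nonneg (by have := den_pos ha haN k; positivity) (hq k)
      · have h1 := add_one_le_den ha haN k
        have hk : (0 : ℝ) ≤ k := Nat.cast_nonneg k
        have hle : pochWeight N a k / ((N : ℝ) * k + a) ≤ 1 := by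
          rw [div_le_one (den_pos ha haN k)]
          exact (pochWeight_le ha haN k).trans h1
        refine (mul_le_of_le_one_right (by positivity) hle).trans ?_
        refine one_div_le_one_div_of_le (by positivity) (h1.trans ?_)
        exact le_self_pow₀ (by linarith) (by omega)
  obtain ⟨x, hx⟩ := hanti.tendsto_alternating_series_of_tendsto_zero hzero
  refine ⟨x, hx.congr fun n => ?_⟩
  rw [tTildeFin_eq_sum N a (by simp)]
  refine Finset.sum_congr rfl fun k _ => ?_
  have h0 : (0 : ℤ) < 2 * (m : ℤ) + 1 := by omega
  have he : (2 * (m : ℤ) + 1).natAbs = 2 * m + 1 := by omega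
  rw [tTildeSummand, tTerm_neg h0, tTerm_of_pos h0, he, hg, pow_succ]
  have := den_pos ha haN k
  field_simp

theorem exists_tendsto_tTildeFin {N a : ℕ} (ha : 1 ≤ a) (haN : a ≤ N) (d : ℕ)
    (b : Fin (d + 1) → ℕ) (c : Fin d → ℕ) (hedge : d = 0 → b 0 = 0 → a < N)
    (p : ℕ × List ℤ) (hp : p ∈ contractions (halfIndex d b c)) :
    ∃ x : ℝ, Tendsto (tTildeFin N a p.2) atTop (𝓝 x) := by
  cases d with
  | zero =>
    have hp' : p = (0, [-(2 * (b 0 : ℤ) + 1)]) := by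
      simpa [halfIndex, contractions, contractionsFrom] using hp
    subst hp'
    exact exists_tendsto_tTildeFin_singleton ha haN (b 0) (hedge rfl)
  | succ d =>
    rw [halfIndex_eq_cons, contractions] at hp
    set e := headEntry (d + 1) b with he
    have he2 : 2 ≤ e := by
      simp only [he, headEntry]
      omega
    have hne : tailIndex (d + 1) b c ≠ [] := by simp [tailIndex]
    have hpos := tailIndex_pos (d + 1) b c
    have hsum := (summable_tTerm_mul_interpSum ha haN he2 hne hpos
      (two_le_getLast_tailIndex (d + 1) b c hne)).mul_left (2 ^ p.1)
    have hs : Summable (tTildeSummand N a p.2) := by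
      refine Summable.of_norm_bounded hsum fun k => ?_
      have h := abs_tTildeSummand_le ha haN hpos (by omega) hp k
      rw [tTerm_neg (by omega), abs_mul, abs_pow, abs_neg, abs_one, one_pow, one_mul,
        abs_of_nonneg (tTerm_nonneg (by omega) k)] at h
      exact h
    exact ⟨_, hs.hasSum.tendsto_sum_nat.congr fun n =>
      (tTildeFin_eq_sum N a (ne_nil_of_mem_contractionsFrom hp) n).symm⟩

theorem two_mul_prod_two_pow {d : ℕ} {c : Fin d → ℕ} (hc : ∀ i, 3 ≤ c i) :
    2 * ∏ i, (2 : ℝ) ^ (c i - 2) = (2 : ℝ) ^ ((∑ i, (c i : ℤ)) + 1 - 2 * (d : ℤ)) := by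
  have h : ((∑ i, (c i - 2) : ℕ) : ℤ) = ∑ i, (c i : ℤ) - 2 * d := by
    rw [Nat.cast_sum, Finset.sum_congr rfl fun i _ => Nat.cast_sub (show 2 ≤ c i by
      have := hc i
      omega), Finset.sum_sub_distrib]
    simp [mul_comm]
  rw [Finset.prod_pow_eq_pow_sum, ← zpow_natCast, h, show (∑ i, (c i : ℤ)) + 1 - 2 * (d : ℤ)
    = 1 + ((∑ i, (c i : ℤ)) - 2 * d) by ring, zpow_add₀ two_ne_zero, zpow_one]

end

theorem mainTheorem10 (N a : ℕ) (ha : 1 ≤ a) (haN : a ≤ N)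
    (d : ℕ) (b : Fin (d + 1) → ℕ) (c : Fin d → ℕ) (hc : ∀ i, 3 ≤ c i)
    (hedge : d = 0 → b 0 = 0 → a < N) :
    (∃ x : ℝ, Tendsto (tStarFin N a (blocksOfTwos d b c)) atTop (𝓝 x)) ∧
    (∀ p ∈ contractions (halfIndex d b c),
      ∃ x : ℝ, Tendsto (tTildeFin N a p.2) atTop (𝓝 x)) ∧
    tStar N a (blocksOfTwos d b c) =
      (2 : ℝ) ^ ((∑ i, (c i : ℤ)) + 1 - 2 * (d : ℤ)) * N /
          ProbabilityTheory.beta ((a : ℝ) / N) ((a : ℝ) / N) *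
        tTildeInterp N a (1 / 2) (halfIndex d b c) := by
  have hN : (0 : ℝ) < N := by exact_mod_cast ha.trans haN
  have hx : 0 < (a : ℝ) / N := div_pos (by exact_mod_cast ha) hN
  have hconv := exists_tendsto_tTildeFin ha haN d b c hedge
  have hinterp : Tendsto (fun n => ((contractions (halfIndex d b c)).map fun p =>
      (1 / 2 : ℝ) ^ p.1 * tTildeFin N a p.2 n).sum) atTop
      (𝓝 (tTildeInterp N a (1 / 2) (halfIndex d b c))) :=
    tendsto_list_sum _ fun p hp => (tendsto_nhds_limUnder (hconv p hp)).const_mul _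
  have hpartial : ∀ n, ((contractions (halfIndex d b c)).map fun p =>
      (1 / 2 : ℝ) ^ p.1 * tTildeFin N a p.2 n).sum
      = ∑ k ∈ Finset.range n, (-1) ^ k *
        (tTerm N a (headEntry d b) k * interpSum N a (tailIndex d b c) k) := by
    intro n
    have h0 : -headEntry d b ≠ 0 := neg_ne_zero.2 (headEntry_pos d b).ne'
    simp only [← mul_assoc, ← tTerm_neg (headEntry_pos d b)]
    simp only [← sum_contractionsFrom N a (tailIndex_pos d b c) h0]
    rw [← sum_map_sum_comm, halfIndex_eq_cons, contractions]
    congr 1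
    refine List.map_congr_left fun p hp => ?_
    rw [tTildeFin_eq_sum N a (ne_nil_of_mem_contractionsFrom hp), Finset.mul_sum]
  have hlim := (tendsto_sum_kernel_mul hx (hinterp.congr hpartial)).const_mul
    (2 * N * ∏ i, (2 : ℝ) ^ (c i - 2))
  have hstar : Tendsto (tStarFin N a (blocksOfTwos d b c)) atTop
      (𝓝 ((2 : ℝ) ^ ((∑ i, (c i : ℤ)) + 1 - 2 * (d : ℤ)) * N /
          ProbabilityTheory.beta ((a : ℝ) / N) ((a : ℝ) / N) *
        tTildeInterp N a (1 / 2) (halfIndex d b c))) := by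
    convert hlim using 2
    · rename_i n
      rw [tStarFin_blocksOfTwos ha haN d b c hc n, kernelSum]
      congr 1
      exact Finset.sum_congr rfl fun k _ => by ring
    · rw [← two_mul_prod_two_pow hc]
      ring
  exact ⟨⟨_, hstar⟩, hconv, hstar.limUnder_eq⟩
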